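/- For a finite set $\mathcal B$ of positive integers, a set $\mathcal P$ of primes and a real $z$, let $\mathcal S(\mathcal B,\mathcal P,z)$ be the number of $n\in\mathcal B$ that have no prime factor $p\in\mathcal P$ with $p\le z$. An interval $I$ means a set of consecutive positive integers $\{a+1,\dots,a+N\}$, and $|I|=N$ is its length. Let $\kappa>0$, $K>0$ and $u_0>1$. There is a constant $c>0$, depending only on $\kappa,K,u_0$, such that the following holds for every real $z\ge 2$ and every set of primes $\mathcal P$ with $$\#\{p\in\mathcal P:\ p\le y\}\ \ge\ \kappa\,\pi(y)\qquad\text{for all real } y\in(\sqrt z,z].$$ For every real $u$ with $u_0\le u\le K\sqrt z$ there are intervals $I_+$ and $I_-$ of length $\ge z^u$ such that $$\mathcal S(I_+,\mathcal P,z)\ \ge\ \Big\{1+\Big(\frac{c}{u\log u}\Big)^u\Big\}\,|I_+|\prod_{p\in\mathcal P,\ p\le z}\Big(1-\frac1p\Big)$$ and $$\mathcal S(I_-,\mathcal P,z)\ \le\ \Big\{1-\Big(\frac{c}{u\log u}\Big)^u\Big\}\,|I_-|\prod_{p\in\mathcal P,\ p\le z}\Big(1-\frac1p\Big).$$ Moreover,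 for every $\varepsilon>0$ there is a $z_1$, depending only on $\kappa,K,u_0,\varepsilon$, such that if in addition $z\ge z_1$ and $u\le(1-\varepsilon)\log\log z/\log\log\log z$, then $I_+$ and $I_-$ can be chosen to have length $\le z^{u+2}$ as well (with the same $c$). -/

import Mathlib

/-- The sifting function: the number of integers `n` in the finite set `B` that have no
prime factor `p ∈ P` with `p ≤ z`. -/
noncomputable def siftedCount (B : Finset ℕ) (P : Set ℕ) (z : ℝ) : ℕ :=
  Set.ncard {n : ℕ | n ∈ B ∧ ∀ p ∈ P, (p : ℝ) ≤ z → ¬ p ∣ n}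

open Classical in
/-- The expected density of the sifted set: the product of `1 - 1/p` over all `p ∈ P`
with `p ≤ z`. -/
noncomputable def sieveDensity (P : Set ℕ) (z : ℝ) : ℝ :=
  ∏ p ∈ (Finset.range (⌊z⌋₊ + 1)).filter (fun p => p ∈ P), (1 - 1 / (p : ℝ))

/-- The set `P` contains at least the proportion `κ` of the primes up to `y`, for every real
`y` in `(√z, z]`. -/
def HasPrimeProportion (P : Set ℕ) (κ z : ℝ) : Prop :=
  ∀ y : ℝ, √z < y → y ≤ z →
    κ * (Nat.primeCounting ⌊y⌋₊ : ℝ) ≤ (Set.ncard {p : ℕ | p ∈ P ∧ (p : ℝ) ≤ y} : ℝ)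

/-! Write E_A(x) for `siftError A x`. Take J disjoint sets G_i of primes in P ∩ [w, z]. By
inclusion-exclusion, the alternating sum of E(x) over unions of subfamilies is a signed sum of
fractional parts {x/∏ D_i}, with D_i running over the nonempty subsets of G_i. If x < w^J, every
such quotient is below 1 and equals its fractional part. Singletons D_i then contribute -x ∏ (∑_{p ∈
G_i} 1/p), which dominates the rest when the total reciprocal sum is at most 1/4
(`abs_siftDiff_add_le`). Only 2^J errors enter, so one of them is large.

Buchstab's recursion E_{A ∪ {q}}(x) = E_A(x) - E_A(x/q) turns a one-sided bound on errors into a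
two-sided one, so large errors of both signs occur (`exists_le_mul_siftError`). The remaining primes
of P are restored by averaging over translates of the interval (`exists_siftedSet_union`).

For large z take w = z^(1-η) with η ≍ 1/log(u+2), and J = u + O(ηu + 1). Chebyshev's bounds give
reciprocal sum ≫ η on P ∩ [w, z], so each G_i can have sum g ≍ η/J ≍ 1/(u log u), and g^J is (c/(u
log u))^u after adjusting c (`exists_pow_bound`). For bounded z, sifting by one prime suffices once
c is small (`exists_intervals_of_prime`). -/

open Finset

/-! ### The sifting error and its inclusion-exclusion recursion. -/

/-- The elements of `(a, a + N]` that are divisible by no element of `A`. -/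
def siftedSet (A : Finset ℕ) (a N : ℕ) : Finset ℕ :=
  (Ioc a (a + N)).filter fun n => ∀ p ∈ A, ¬ p ∣ n

/-- The deviation of the number of `n ≤ x` divisible by no element of `A` from its expected
value. -/
noncomputable def siftError (A : Finset ℕ) (x : ℝ) : ℝ :=
  ((siftedSet A 0 ⌊x⌋₊).card : ℝ) - x * ∏ p ∈ A, (1 - 1 / (p : ℝ))

lemma siftError_empty {x : ℝ} (hx : 0 ≤ x) : siftError ∅ x = -Int.fract x := by
  have h := Int.self_sub_floor x
  rw [← natCast_floor_eq_intCast_floor hx] at h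
  simp [siftError, siftedSet, ← h]

lemma siftedSet_card_insert {A : Finset ℕ} {q : ℕ} (hA : ∀ p ∈ A, p.Prime) (hq : q.Prime)
    (hqA : q ∉ A) (m : ℕ) :
    (siftedSet A 0 m).card = (siftedSet (insert q A) 0 m).card + (siftedSet A 0 (m / q)).card := by
  have h1 : siftedSet (insert q A) 0 m = (siftedSet A 0 m).filter fun n => ¬ q ∣ n := by
    ext n
    simp only [siftedSet, mem_filter, mem_insert, forall_eq_or_imp]
    tauto
  have h2 : ((siftedSet A 0 m).filter fun n => q ∣ n) = (siftedSet A 0 (m / q)).image (q * ·) := by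
    ext n
    simp only [siftedSet, mem_filter, mem_image, mem_Ioc, zero_add]
    constructor
    · rintro ⟨⟨⟨h0, hm⟩, hA'⟩, k, rfl⟩
      refine ⟨k, ⟨⟨Nat.pos_of_mul_pos_left h0, ?_⟩, fun p hp hpk => hA' p hp (hpk.mul_left q)⟩, rfl⟩
      rw [Nat.le_div_iff_mul_le hq.pos, mul_comm]
      exact hm
    · rintro ⟨k, ⟨⟨h0, hm⟩, hA'⟩, rfl⟩
      rw [Nat.le_div_iff_mul_le hq.pos, mul_comm] at hm
      refine ⟨⟨⟨Nat.mul_pos hq.pos h0, hm⟩, fun p hp hpk => ?_⟩, dvd_mul_right _ _⟩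
      rcases (hA p hp).dvd_mul.1 hpk with h | h
      · rw [(Nat.prime_dvd_prime_iff_eq (hA p hp) hq).1 h] at hp
        exact hqA hp
      · exact hA' p hp h
  rw [h1, ← card_image_of_injective (siftedSet A 0 (m / q))
    (fun _ _ h => Nat.eq_of_mul_eq_mul_left hq.pos h), ← h2, add_comm]
  exact (card_filter_add_card_filter_not _).symm

lemma siftError_insert {A : Finset ℕ} {q : ℕ} (hA : ∀ p ∈ A, p.Prime) (hq : q.Prime)
    (hqA : q ∉ A) (x : ℝ) :
    siftError (insert q A) x = siftError A x - siftError A (x / q) := by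
  have h := siftedSet_card_insert hA hq hqA ⌊x⌋₊
  rw [← Nat.floor_div_natCast] at h
  rw [siftError, siftError, siftError, prod_insert hqA, h]
  push_cast
  ring

lemma siftError_union {B G : Finset ℕ} (hB : ∀ p ∈ B, p.Prime) (hG : ∀ p ∈ G, p.Prime)
    (hd : Disjoint B G) (x : ℝ) :
    siftError (B ∪ G) x = ∑ D ∈ G.powerset, (-1) ^ D.card * siftError B (x / ∏ p ∈ D, (p : ℝ)) := by
  induction G using Finset.induction_on generalizing x with
  | empty => simp
  | insert q G hq ih =>
    rw [disjoint_insert_right] at hd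
    have hG' : ∀ p ∈ G, p.Prime := fun p hp => hG p (mem_insert_of_mem hp)
    rw [union_insert, siftError_insert (fun p hp => (mem_union.1 hp).elim (hB p) (hG' p))
      (hG q (mem_insert_self q G)) (by simp [hd.1, hq]), ih hG' hd.2, ih hG' hd.2,
      sum_powerset_insert hq, sub_eq_add_neg, ← sum_neg_distrib]
    congr 1
    refine sum_congr rfl fun D hD => ?_
    have hqD : q ∉ D := fun h => hq (mem_powerset.1 hD h)
    rw [card_insert_of_notMem hqD, prod_insert hqD, div_div]
    ring

/-! ### A lower bound for alternating sums of sifting errors. -/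

/-- The alternating sum of `siftError (B ∪ ⋃ G)` over the subfamilies of the family `Gs`. -/
noncomputable def siftDiff : List (Finset ℕ) → Finset ℕ → ℝ → ℝ
  | [], B, x => siftError B x
  | G :: Gs, B, x => siftDiff Gs B x - siftDiff Gs (B ∪ G) x

lemma siftDiff_union (Gs : List (Finset ℕ)) {B G : Finset ℕ} (hB : ∀ p ∈ B, p.Prime)
    (hG : ∀ p ∈ G, p.Prime) (hd : Disjoint B G) (hGs : ∀ H ∈ Gs, ∀ p ∈ H, p.Prime)
    (hdG : ∀ H ∈ Gs, Disjoint H G) (x : ℝ) :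
    siftDiff Gs (B ∪ G) x
      = ∑ D ∈ G.powerset, (-1) ^ D.card * siftDiff Gs B (x / ∏ p ∈ D, (p : ℝ)) := by
  induction Gs generalizing B x with
  | nil => exact siftError_union hB hG hd x
  | cons H Gs ih =>
    have hH : ∀ p ∈ H, p.Prime := hGs H List.mem_cons_self
    have hHG : Disjoint H G := hdG H List.mem_cons_self
    have hGs' : ∀ H ∈ Gs, ∀ p ∈ H, p.Prime := fun K hK => hGs K (List.mem_cons_of_mem _ hK)
    have hdG' : ∀ H ∈ Gs, Disjoint H G := fun K hK => hdG K (List.mem_cons_of_mem _ hK)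
    simp only [siftDiff, mul_sub, sum_sub_distrib]
    rw [ih hB hd hGs' hdG', union_right_comm,
      ih (fun p hp => (mem_union.1 hp).elim (hB p) (hH p)) (disjoint_union_left.2 ⟨hd, hHG⟩)
        hGs' hdG']

/-- The union of a family of finite sets. -/
def unionList (Gs : List (Finset ℕ)) : Finset ℕ := Gs.foldr (· ∪ ·) ∅

lemma abs_siftDiff_le (Gs : List (Finset ℕ)) (B : Finset ℕ) {x M : ℝ}
    (hM : ∀ A ⊆ B ∪ unionList Gs, |siftError A x| ≤ M) :
    |siftDiff Gs B x| ≤ 2 ^ Gs.length * M := by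
  induction Gs generalizing B with
  | nil => simpa [siftDiff] using hM B subset_union_left
  | cons G Gs ih =>
    have h1 := ih B fun A hA => hM A (hA.trans
      (union_subset_union_right subset_union_right))
    have h2 := ih (B ∪ G) fun A hA => hM A (hA.trans (by rw [union_assoc]; rfl))
    rw [siftDiff, List.length_cons, pow_succ]
    calc _ ≤ |siftDiff Gs B x| + |siftDiff Gs (B ∪ G) x| := abs_sub _ _
      _ ≤ _ := by linarith

/-- The sum of the reciprocals of the elements of `G`. -/
noncomputable def recipSum (G : Finset ℕ) : ℝ := ∑ p ∈ G, 1 / (p : ℝ)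

/-- The sum of the reciprocals of the products over the nonempty subsets of `G`. -/
noncomputable def recipProd (G : Finset ℕ) : ℝ := ∏ p ∈ G, (1 + 1 / (p : ℝ)) - 1

lemma recipSum_nonneg (G : Finset ℕ) : 0 ≤ recipSum G := sum_nonneg fun _ _ => by positivity

lemma recipProd_eq (G : Finset ℕ) :
    recipProd G = ∑ D ∈ G.powerset.erase ∅, 1 / ∏ p ∈ D, (p : ℝ) := by
  rw [recipProd, prod_one_add, ← sum_erase_add _ _ (empty_mem_powerset G)]
  simp

lemma recipProd_le (G : Finset ℕ) :
    recipProd G ≤ recipSum G * Real.exp (recipSum G) := by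
  have h1 : ∏ p ∈ G, (1 + 1 / (p : ℝ)) ≤ Real.exp (recipSum G) := by
    rw [recipSum, Real.exp_sum]
    exact prod_le_prod (fun _ _ => by positivity) fun p _ => by
      rw [add_comm]; exact Real.add_one_le_exp _
  -- From 1 - s ≤ e^(-s) follows e^s - 1 ≤ s e^s.
  have h2 : Real.exp (recipSum G) * (1 - recipSum G) ≤ 1 := by
    have := Real.add_one_le_exp (-recipSum G)
    calc _ ≤ Real.exp (recipSum G) * Real.exp (-recipSum G) := by gcongr; linarith
      _ = 1 := by rw [← Real.exp_add]; simp
  rw [recipProd]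
  linarith

lemma recipSum_eq (G : Finset ℕ) :
    recipSum G = ∑ D ∈ (G.powerset.erase ∅).filter (fun D => D.card = 1), 1 / ∏ p ∈ D, (p : ℝ) := by
  rw [recipSum]
  refine sum_bij (fun p _ => {p}) ?_ ?_ ?_ ?_
  · intro p hp; simpa using hp
  · intro p _ q _ h; simpa using h
  · intro D hD
    simp only [mem_filter, mem_erase, mem_powerset] at hD
    obtain ⟨p, rfl⟩ := card_eq_one.1 hD.2
    exact ⟨p, by simpa using hD.1.2, rfl⟩
  · intro p _; simp

lemma recipSum_le_recipProd (G : Finset ℕ) : recipSum G ≤ recipProd G := by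
  rw [recipSum_eq, recipProd_eq]
  exact sum_le_sum_of_subset_of_nonneg (filter_subset _ _) fun D _ _ => by positivity

lemma listProd_recipSum_nonneg (Gs : List (Finset ℕ)) : 0 ≤ (Gs.map recipSum).prod :=
  List.prod_nonneg fun _ h => by
    obtain ⟨G, -, rfl⟩ := List.mem_map.1 h
    exact recipSum_nonneg G

lemma listProd_recipSum_le (Gs : List (Finset ℕ)) :
    (Gs.map recipSum).prod ≤ (Gs.map recipProd).prod := by
  induction Gs with
  | nil => simp
  | cons G Gs ih =>
    simp only [List.map_cons, List.prod_cons]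
    have := recipSum_nonneg G
    have := recipSum_le_recipProd G
    have := listProd_recipSum_nonneg Gs
    gcongr
    linarith

lemma listProd_recipProd_le (Gs : List (Finset ℕ)) :
    (Gs.map recipProd).prod ≤ (Gs.map recipSum).prod * Real.exp (Gs.map recipSum).sum := by
  induction Gs with
  | nil => simp
  | cons G Gs ih =>
    simp only [List.map_cons, List.prod_cons, List.sum_cons, Real.exp_add]
    have h0 := recipSum_nonneg G
    have h1 := (listProd_recipSum_nonneg Gs).trans (listProd_recipSum_le Gs)
    calc _ ≤ (recipSum G * Real.exp (recipSum G)) *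
          ((Gs.map recipSum).prod * Real.exp (Gs.map recipSum).sum) :=
          mul_le_mul (recipProd_le G) ih h1 (by positivity)
      _ = _ := by ring

/-- Induction on the family. Expanding over D ⊆ G, the term D = ∅ cancels `siftDiff Gs ∅ x`; every
other D divides x by at least w, which pays for one group in x < w^J. Singletons carry the main
term. For the empty family x < 1, so the error is exactly -x. -/
lemma abs_siftDiff_add_le {w : ℝ} (hw : 1 ≤ w) (Gs : List (Finset ℕ))
    (hGs : ∀ G ∈ Gs, ∀ p ∈ G, p.Prime ∧ w ≤ p) (hd : Gs.Pairwise Disjoint) {x : ℝ} (hx : 0 ≤ x)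
    (hxw : x < w ^ Gs.length) :
    |siftDiff Gs ∅ x + x * (Gs.map recipSum).prod|
      ≤ x * ((Gs.map recipProd).prod - (Gs.map recipSum).prod) := by
  induction Gs generalizing x with
  | nil =>
    simp only [List.length_nil, pow_zero] at hxw
    simp [siftDiff, siftError_empty hx, Int.fract_eq_self.2 ⟨hx, hxw⟩]
  | cons G Gs ih =>
    rw [List.pairwise_cons] at hd
    have hG := hGs G List.mem_cons_self
    have hGs' : ∀ H ∈ Gs, ∀ p ∈ H, p.Prime ∧ w ≤ p := fun H hH => hGs H (List.mem_cons_of_mem _ hH)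
    have key := siftDiff_union Gs (B := ∅) (G := G) (by simp) (fun p hp => (hG p hp).1)
      (disjoint_empty_left _) (fun H hH p hp => (hGs' H hH p hp).1)
      (fun H hH => (hd.1 H hH).symm) x
    simp only [List.map_cons, List.prod_cons, siftDiff]
    set Λ := (Gs.map recipSum).prod
    set M := (Gs.map recipProd).prod
    have hΛM : Λ ≤ M := listProd_recipSum_le Gs
    have hΛ : 0 ≤ Λ := listProd_recipSum_nonneg Gs
    rw [key, ← sum_erase_add _ _ (empty_mem_powerset G)]
    have e1 : siftDiff Gs ∅ x
        - (∑ D ∈ G.powerset.erase ∅, (-1) ^ D.card * siftDiff Gs ∅ (x / ∏ p ∈ D, (p : ℝ))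
          + (-1) ^ (∅ : Finset ℕ).card * siftDiff Gs ∅ (x / ∏ p ∈ (∅ : Finset ℕ), (p : ℝ)))
        + x * (recipSum G * Λ)
        = ∑ D ∈ G.powerset.erase ∅, (-((-1) ^ D.card * siftDiff Gs ∅ (x / ∏ p ∈ D, (p : ℝ)))
          + if D.card = 1 then (x / ∏ p ∈ D, (p : ℝ)) * Λ else 0) := by
      rw [sum_add_distrib, sum_neg_distrib, ← sum_filter, recipSum_eq, sum_mul, mul_sum]
      simp only [card_empty, prod_empty, pow_zero, div_one, one_mul]
      have : ∀ D : Finset ℕ, x * (1 / (∏ p ∈ D, (p : ℝ)) * Λ) = x / (∏ p ∈ D, (p : ℝ)) * Λ :=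
        fun D => by ring
      simp only [this]
      ring
    have e2 : x * (recipProd G * M - recipSum G * Λ)
        = ∑ D ∈ G.powerset.erase ∅, ((x / ∏ p ∈ D, (p : ℝ)) * M
          - if D.card = 1 then (x / ∏ p ∈ D, (p : ℝ)) * Λ else 0) := by
      rw [sum_sub_distrib, ← sum_filter, recipSum_eq, recipProd_eq, sum_mul, sum_mul, mul_sub,
        mul_sum, mul_sum]
      congr 1 <;> exact sum_congr rfl fun D _ => by ring
    rw [e1, e2]
    refine (abs_sum_le_sum_abs _ _).trans (sum_le_sum fun D hD => ?_)
    rw [mem_erase, mem_powerset] at hD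
    obtain ⟨p, hp⟩ := nonempty_iff_ne_empty.2 hD.1
    have hone : ∀ q ∈ D, (1 : ℝ) ≤ q := fun q hq => hw.trans (hG q (hD.2 hq)).2
    have hprod : w ≤ ∏ q ∈ D, (q : ℝ) := by
      rw [← mul_prod_erase D (fun q => (q : ℝ)) hp]
      have := (hG p (hD.2 hp)).2
      have h3 : (1 : ℝ) ≤ ∏ q ∈ D.erase p, (q : ℝ) :=
        Finset.one_le_prod fun q hq => hone q (mem_of_mem_erase hq)
      nlinarith
    have hpos : (0 : ℝ) < ∏ q ∈ D, (q : ℝ) := by linarith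
    have hy : 0 ≤ x / ∏ q ∈ D, (q : ℝ) := by positivity
    have hyw : x / ∏ q ∈ D, (q : ℝ) < w ^ Gs.length := by
      rw [div_lt_iff₀ hpos]
      rw [List.length_cons, pow_succ] at hxw
      exact hxw.trans_le (by gcongr)
    have h := ih hGs' hd.2 hy hyw
    set y := x / ∏ q ∈ D, (q : ℝ)
    split_ifs with h1
    · simpa [h1, mul_sub] using h
    -- For at least two primes only the size matters: the induction hypothesis and Λ ≥ 0 bound the
    -- term by yM.
    · rw [add_zero, sub_zero, abs_neg, abs_mul, abs_pow, abs_neg, abs_one, one_pow, one_mul]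
      have := mul_nonneg hy hΛ
      rw [abs_le] at h ⊢
      constructor <;> nlinarith

/-- Some subset of the union of the family `Gs` has a large sifting error at `x`. -/
lemma exists_le_abs_siftError {w : ℝ} (hw : 1 ≤ w) (Gs : List (Finset ℕ))
    (hGs : ∀ G ∈ Gs, ∀ p ∈ G, p.Prime ∧ w ≤ p) (hd : Gs.Pairwise Disjoint) {x M : ℝ} (hx : 0 ≤ x)
    (hxw : x < w ^ Gs.length) (hs : (Gs.map recipSum).sum ≤ 1 / 4)
    (hM : ∀ A ⊆ unionList Gs, |siftError A x| ≤ M) :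
    x * (Gs.map recipSum).prod ≤ 2 ^ Gs.length * (2 * M) := by
  have h1 := abs_siftDiff_add_le hw Gs hGs hd hx hxw
  have h2 := abs_siftDiff_le Gs ∅ (x := x) (M := M) (by simpa using hM)
  have h3 := listProd_recipProd_le Gs
  have h0 := listProd_recipSum_nonneg Gs
  have h4 : Real.exp (Gs.map recipSum).sum ≤ 3 / 2 := by
    refine (Real.exp_le_exp.2 hs).trans ?_
    have := Real.add_one_le_exp (-(1 / 4) : ℝ)
    rw [Real.exp_neg] at this
    have h5 := mul_inv_cancel₀ (Real.exp_pos (1 / 4)).ne'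
    have h6 := Real.exp_pos (1 / 4)
    nlinarith
  have h5 : (Gs.map recipProd).prod ≤ (Gs.map recipSum).prod * (3 / 2) :=
    h3.trans (by gcongr)
  rw [abs_le] at h1 h2
  nlinarith

/-! ### Large errors of both signs. -/

/-- Peeling off all primes gives E_A(x) = -{x} - ∑ E_B(x/q), with B the primes inserted before q.
Each x/q lies in [Y, x], so upper bounds for s·E there become a lower bound at x. -/
lemma neg_le_mul_siftError {s d x Y : ℝ} (hs : |s| ≤ 1) (hx : 0 ≤ x) {A : Finset ℕ}
    (hA : ∀ p ∈ A, p.Prime ∧ Y * p ≤ x)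
    (h : ∀ B ⊆ A, ∀ y, Y ≤ y → y ≤ x → s * siftError B y ≤ d * y) :
    -1 - d * x * recipSum A ≤ s * siftError A x := by
  induction A using Finset.induction_on with
  | empty =>
    rw [siftError_empty hx, recipSum, sum_empty]
    have h1 := Int.fract_nonneg x
    have h2 := (Int.fract_lt_one x).le
    rw [abs_le] at hs
    nlinarith
  | insert q A hq ih =>
    have hA' : ∀ p ∈ A, p.Prime ∧ Y * p ≤ x := fun p hp => hA p (mem_insert_of_mem hp)
    have h1 := ih hA' fun B hB => h B (hB.trans (subset_insert q A))
    obtain ⟨hqp, hqx⟩ := hA q (mem_insert_self q A)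
    have hq0 : (0 : ℝ) < q := by exact_mod_cast hqp.pos
    have hq1 : (1 : ℝ) ≤ q := by exact_mod_cast hqp.one_le
    have h2 := h A (subset_insert q A) (x / q) ((le_div_iff₀ hq0).2 hqx) (div_le_self hx hq1)
    rw [siftError_insert (fun p hp => (hA' p hp).1) hqp hq, recipSum, sum_insert hq, mul_sub]
    rw [recipSum] at h1
    have : d * (x / q) = d * x * (1 / q) := by ring
    linarith

lemma unionList_mem {Gs : List (Finset ℕ)} {p : ℕ} : p ∈ unionList Gs ↔ ∃ G ∈ Gs, p ∈ G := by
  induction Gs with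
  | nil => simp [unionList]
  | cons G Gs ih => simp [unionList, ← ih]

lemma recipSum_mono {A B : Finset ℕ} (h : A ⊆ B) : recipSum A ≤ recipSum B :=
  sum_le_sum_of_subset_of_nonneg h fun _ _ _ => by positivity

lemma recipSum_unionList_le (Gs : List (Finset ℕ)) :
    recipSum (unionList Gs) ≤ (Gs.map recipSum).sum := by
  induction Gs with
  | nil => simp [unionList, recipSum]
  | cons G Gs ih =>
    have h : recipSum (G ∪ unionList Gs) ≤ recipSum G + recipSum (unionList Gs) := by
      have := sum_union_inter (s₁ := G) (s₂ := unionList Gs) (f := fun p : ℕ => 1 / (p : ℝ))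
      have h0 := recipSum_nonneg (G ∩ unionList Gs)
      rw [recipSum] at *
      simp only [recipSum]
      linarith
    rw [List.map_cons, List.sum_cons]
    exact h.trans (by gcongr)

/-- Some subset of the union of the family `Gs` has, somewhere in `[Y, x]`, a large sifting error
of prescribed sign. -/
lemma exists_le_mul_siftError {w z s d x Y : ℝ} (hw : 1 ≤ w) (Gs : List (Finset ℕ))
    (hGs : ∀ G ∈ Gs, ∀ p ∈ G, p.Prime ∧ w ≤ p ∧ p ≤ z) (hd : Gs.Pairwise Disjoint) (hx : 0 < x)
    (hxw : x < w ^ Gs.length) (hsum : (Gs.map recipSum).sum ≤ 1 / 4) (hs : s = 1 ∨ s = -1)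
    (hY : 0 ≤ Y) (hYx : Y ≤ x) (hYz : Y * z ≤ x) (hd0 : 0 < d) (hdx : 1 ≤ d * x)
    (hdΛ : d * (8 * 2 ^ Gs.length) ≤ (Gs.map recipSum).prod) :
    ∃ A ⊆ unionList Gs, ∃ y, Y ≤ y ∧ y ≤ x ∧ d * y ≤ s * siftError A y := by
  by_contra! H
  have hs1 : |s| = 1 := by rcases hs with rfl | rfl <;> simp
  -- If no error of sign s is large, all errors at x are at most 2dx in absolute value; then xΛ ≤
  -- 4·2^J·dx for the product Λ of the reciprocal sums, against the 8 in `hdΛ`.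
  have key : ∀ A ⊆ unionList Gs, |siftError A x| ≤ 2 * d * x := by
    intro A hA
    have h1 := neg_le_mul_siftError (s := s) (d := d) (x := x) (Y := Y) hs1.le hx.le (A := A)
      (fun p hp => by
        obtain ⟨G, hG, hpG⟩ := unionList_mem.1 (hA hp)
        obtain ⟨hp1, -, hp2⟩ := hGs G hG p hpG
        exact ⟨hp1, (mul_le_mul_of_nonneg_left hp2 hY).trans hYz⟩)
      (fun B hB y hy hyx => (H B (hB.trans hA) y hy hyx).le)
    have h2 := H A hA x hYx le_rfl
    have h3 := ((recipSum_mono hA).trans (recipSum_unionList_le Gs)).trans hsum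
    have h4 : d * x * recipSum A ≤ d * x * (1 / 4) := by gcongr
    rw [← one_mul |siftError A x|, ← hs1, ← abs_mul, abs_le]
    constructor <;> nlinarith
  have h5 := exists_le_abs_siftError hw Gs (fun G hG p hp => ⟨(hGs G hG p hp).1, (hGs G hG p hp).2.1⟩)
    hd hx.le hxw hsum key
  have h6 : (0 : ℝ) < 2 ^ Gs.length := by positivity
  have h7 := mul_pos (mul_pos hx hd0) h6
  nlinarith

/-! ### Splitting a set of primes into groups of comparable reciprocal sum. -/

/-- Greedy choice: the element that lifts the sum past g adds at most g. -/
lemma exists_subset_recipSum {g : ℝ} (S : Finset ℕ) (hS : ∀ p ∈ S, 1 / (p : ℝ) ≤ g)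
    (h : g ≤ recipSum S) (hg : 0 ≤ g) : ∃ G ⊆ S, g ≤ recipSum G ∧ recipSum G ≤ 2 * g := by
  induction S using Finset.induction_on with
  | empty =>
    exact ⟨∅, subset_rfl, h, by simpa [recipSum] using hg⟩
  | insert q S hq ih =>
    rcases le_total g (recipSum S) with h1 | h1
    · obtain ⟨G, hG, h2⟩ := ih (fun p hp => hS p (mem_insert_of_mem hp)) h1
      exact ⟨G, hG.trans (subset_insert q S), h2⟩
    · refine ⟨insert q S, subset_rfl, h, ?_⟩
      have h2 := hS q (mem_insert_self q S)
      rw [recipSum] at *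
      rw [sum_insert hq]
      linarith

lemma exists_disjoint_family {g : ℝ} (hg : 0 ≤ g) (J : ℕ) (S : Finset ℕ)
    (hS : ∀ p ∈ S, 1 / (p : ℝ) ≤ g) (h : J * (2 * g) ≤ recipSum S) :
    ∃ Gs : List (Finset ℕ), Gs.length = J ∧ Gs.Pairwise Disjoint ∧
      ∀ G ∈ Gs, G ⊆ S ∧ g ≤ recipSum G ∧ recipSum G ≤ 2 * g := by
  induction J generalizing S with
  | zero => exact ⟨[], rfl, List.Pairwise.nil, by simp⟩
  | succ J ih =>
    push_cast at h
    have hJ : 0 ≤ J * (2 * g) := by positivity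
    obtain ⟨G, hG, hG1, hG2⟩ := exists_subset_recipSum S hS (by linarith) hg
    have hsd : recipSum (S \ G) + recipSum G = recipSum S := sum_sdiff hG
    obtain ⟨Gs, h1, h2, h3⟩ := ih (S \ G) (fun p hp => hS p (mem_sdiff.1 hp).1) (by linarith)
    refine ⟨G :: Gs, by simp [h1], List.pairwise_cons.2 ⟨fun H hH => ?_, h2⟩, ?_⟩
    · exact disjoint_sdiff.mono_right (h3 H hH).1
    · rintro H hH
      rcases List.mem_cons.1 hH with rfl | hH
      · exact ⟨hG, hG1, hG2⟩
      · exact ⟨(h3 H hH).1.trans sdiff_subset, (h3 H hH).2⟩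

lemma listSum_le_of_forall_le {Gs : List (Finset ℕ)} {b : ℝ} (h : ∀ G ∈ Gs, recipSum G ≤ b) :
    (Gs.map recipSum).sum ≤ Gs.length * b := by
  induction Gs with
  | nil => simp
  | cons G Gs ih =>
    have h1 := ih fun H hH => h H (List.mem_cons_of_mem _ hH)
    have h2 := h G List.mem_cons_self
    simp only [List.map_cons, List.sum_cons, List.length_cons]
    push_cast
    linarith

lemma pow_le_listProd {Gs : List (Finset ℕ)} {g : ℝ} (hg : 0 ≤ g) (h : ∀ G ∈ Gs, g ≤ recipSum G) :
    g ^ Gs.length ≤ (Gs.map recipSum).prod := by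
  induction Gs with
  | nil => simp
  | cons G Gs ih =>
    have h1 := ih fun H hH => h H (List.mem_cons_of_mem _ hH)
    have h2 := h G List.mem_cons_self
    simp only [List.map_cons, List.prod_cons, List.length_cons, pow_succ']
    gcongr
    exact recipSum_nonneg G

/-! ### Restoring the remaining primes by averaging over translates. -/

lemma siftedSet_card_offset (A : Finset ℕ) (a N : ℕ) :
    (siftedSet A a N).card = ((Ioc 0 N).filter fun n => ∀ p ∈ A, ¬ p ∣ a + n).card := by
  refine Eq.trans ?_ (card_image_of_injective _ (add_right_injective a))
  congr 1
  ext n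
  simp only [siftedSet, mem_filter, mem_Ioc, mem_image]
  constructor
  · rintro ⟨⟨h1, h2⟩, h3⟩
    exact ⟨n - a, ⟨⟨by omega, by omega⟩, by rwa [Nat.add_sub_cancel' h1.le]⟩, by omega⟩
  · rintro ⟨m, ⟨⟨h1, h2⟩, h3⟩, rfl⟩
    exact ⟨⟨by omega, by omega⟩, h3⟩

lemma card_dvd_progression {q M : ℕ} (hq : q.Prime) (hM : ¬ q ∣ M) (b : ℕ) :
    ((range q).filter fun j => q ∣ b + M * j).card = 1 := by
  have := Fact.mk hq
  have hM' : (M : ZMod q) ≠ 0 := by rwa [Ne, ZMod.natCast_eq_zero_iff]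
  have key : ∀ j, q ∣ b + M * j ↔ (j : ZMod q) = -b * (M : ZMod q)⁻¹ := by
    intro j
    rw [← ZMod.natCast_eq_zero_iff, eq_mul_inv_iff_mul_eq₀ hM']
    push_cast
    rw [mul_comm (j : ZMod q), eq_neg_iff_add_eq_zero, add_comm]
  rw [card_eq_one]
  refine ⟨(-b * (M : ZMod q)⁻¹ : ZMod q).val, ?_⟩
  ext j
  simp only [mem_filter, mem_range, mem_singleton, key]
  constructor
  · rintro ⟨h1, h2⟩
    rw [← h2, ZMod.val_natCast, Nat.mod_eq_of_lt h1]
  · rintro rfl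
    exact ⟨ZMod.val_lt _, by simp⟩

/-- Shifts by multiples of ∏ A preserve divisibility by the primes of A, while q divides each
shifted integer for exactly one of the q shifts. -/
lemma sum_siftedSet_card {A : Finset ℕ} {q : ℕ} (hA : ∀ p ∈ A, p.Prime) (hq : q.Prime)
    (hqA : q ∉ A) (a N : ℕ) :
    ∑ j ∈ range q, (siftedSet (insert q A) (a + (∏ p ∈ A, p) * j) N).card
      = (siftedSet A a N).card * (q - 1) := by
  have hM : ¬ q ∣ ∏ p ∈ A, p := by
    rw [hq.prime.dvd_finsetProd_iff]
    rintro ⟨p, hp, hqp⟩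
    exact hqA (((Nat.prime_dvd_prime_iff_eq hq (hA p hp)).1 hqp) ▸ hp)
  have h1 : ∀ j, (siftedSet (insert q A) (a + (∏ p ∈ A, p) * j) N).card
      = ∑ n ∈ (Ioc 0 N).filter (fun n => ∀ p ∈ A, ¬ p ∣ a + n),
          if ¬ q ∣ (a + n) + (∏ p ∈ A, p) * j then 1 else 0 := by
    intro j
    rw [siftedSet_card_offset, ← card_filter, filter_filter]
    congr 1
    refine filter_congr fun n _ => ?_
    simp only [mem_insert, forall_eq_or_imp]
    rw [add_right_comm, and_comm]
    refine and_congr_left fun _ => forall₂_congr fun p hp => ?_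
    rw [Nat.dvd_add_left ((dvd_prod_of_mem (fun p => p) hp).mul_right j)]
  simp only [h1]
  rw [sum_comm, siftedSet_card_offset, card_eq_sum_ones, sum_mul]
  refine sum_congr rfl fun n _ => ?_
  have h2 := card_filter_add_card_filter_not (s := range q)
    (fun j => q ∣ (a + n) + (∏ p ∈ A, p) * j)
  rw [card_dvd_progression hq hM, card_range] at h2
  rw [← card_filter]
  omega

lemma exists_siftedSet_insert {A : Finset ℕ} {q : ℕ} (hA : ∀ p ∈ A, p.Prime) (hq : q.Prime)
    (hqA : q ∉ A) (a N : ℕ) :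
    (∃ b, (siftedSet A a N).card * (1 - 1 / (q : ℝ)) ≤ (siftedSet (insert q A) b N).card) ∧
    ∃ b, ((siftedSet (insert q A) b N).card : ℝ) ≤ (siftedSet A a N).card * (1 - 1 / (q : ℝ)) := by
  have h := congrArg (Nat.cast : ℕ → ℝ) (sum_siftedSet_card hA hq hqA a N)
  have hq0 : (q : ℝ) ≠ 0 := by exact_mod_cast hq.ne_zero
  have hne : (range q).Nonempty := nonempty_range_iff.2 hq.ne_zero
  have h2 : ((siftedSet A a N).card * (q - 1 : ℕ) : ℝ)
      = ∑ _j ∈ range q, (siftedSet A a N).card * (1 - 1 / (q : ℝ)) := by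
    rw [sum_const, card_range, nsmul_eq_mul, Nat.cast_sub hq.one_le]
    field_simp
    simp
  push_cast [-Nat.cast_sub] at h
  rw [h2] at h
  obtain ⟨j, -, hj⟩ := exists_le_of_sum_le hne h.ge
  obtain ⟨k, -, hk⟩ := exists_le_of_sum_le hne h.le
  exact ⟨⟨_, hj⟩, ⟨_, hk⟩⟩

lemma one_sub_recip_nonneg (p : ℕ) : (0 : ℝ) ≤ 1 - 1 / p := by
  rcases Nat.eq_zero_or_pos p with rfl | hp
  · simp
  · rw [sub_nonneg, div_le_one (by exact_mod_cast hp)]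
    exact_mod_cast hp

lemma exists_siftedSet_union {A R : Finset ℕ} (hA : ∀ p ∈ A, p.Prime) (hR : ∀ p ∈ R, p.Prime)
    (hd : Disjoint A R) (a N : ℕ) :
    (∃ b, (siftedSet A a N).card * ∏ p ∈ R, (1 - 1 / (p : ℝ)) ≤ (siftedSet (A ∪ R) b N).card) ∧
    ∃ b, ((siftedSet (A ∪ R) b N).card : ℝ)
      ≤ (siftedSet A a N).card * ∏ p ∈ R, (1 - 1 / (p : ℝ)) := by
  induction R using Finset.induction_on with
  | empty => exact ⟨⟨a, by simp⟩, ⟨a, by simp⟩⟩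
  | insert q R hq ih =>
    rw [disjoint_insert_right] at hd
    have hR' : ∀ p ∈ R, p.Prime := fun p hp => hR p (mem_insert_of_mem hp)
    obtain ⟨⟨b, hb⟩, ⟨b', hb'⟩⟩ := ih hR' hd.2
    have hAR : ∀ p ∈ A ∪ R, p.Prime := fun p hp => (mem_union.1 hp).elim (hA p) (hR' p)
    have hqAR : q ∉ A ∪ R := by simp [hd.1, hq]
    have hqp := hR q (mem_insert_self q R)
    have h0 := one_sub_recip_nonneg q
    rw [union_insert, prod_insert hq, mul_left_comm, mul_comm]
    obtain ⟨c, hc⟩ := (exists_siftedSet_insert hAR hqp hqAR b N).1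
    obtain ⟨c', hc'⟩ := (exists_siftedSet_insert hAR hqp hqAR b' N).2
    exact ⟨⟨c, (mul_le_mul_of_nonneg_right hb h0).trans hc⟩,
      ⟨c', hc'.trans (mul_le_mul_of_nonneg_right hb' h0)⟩⟩

open Classical in
/-- The elements of `P` that are at most `z`. -/
noncomputable def elementsUpTo (P : Set ℕ) (z : ℝ) : Finset ℕ :=
  (range (⌊z⌋₊ + 1)).filter fun p => p ∈ P

lemma mem_elementsUpTo {P : Set ℕ} {z : ℝ} (hz : 0 ≤ z) {p : ℕ} :
    p ∈ elementsUpTo P z ↔ p ∈ P ∧ (p : ℝ) ≤ z := by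
  simp only [elementsUpTo, mem_filter, mem_range, Nat.lt_succ_iff, Nat.le_floor_iff hz, and_comm]

lemma siftedCount_eq (P : Set ℕ) {z : ℝ} (hz : 0 ≤ z) (a N : ℕ) :
    siftedCount (Ioc a (a + N)) P z = (siftedSet (elementsUpTo P z) a N).card := by
  rw [siftedCount, ← Set.ncard_coe_finset]
  congr 1
  ext n
  simp only [siftedSet, coe_filter, Set.mem_ofPred_eq, mem_elementsUpTo hz, and_imp]

/-- A deviation δN is at least δN times the density of A, hence a relative deviation δ; averaging
preserves it when the other primes are added. -/
lemma exists_siftedCount {P : Set ℕ} (hP : ∀ p ∈ P, p.Prime) {z δ : ℝ} (hz : 0 ≤ z) (hδ : 0 ≤ δ)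
    {A : Finset ℕ} (hA : A ⊆ elementsUpTo P z) (a N : ℕ) :
    (N * ∏ p ∈ A, (1 - 1 / (p : ℝ)) + δ * N ≤ (siftedSet A a N).card →
      ∃ b, (1 + δ) * (N * sieveDensity P z) ≤ siftedCount (Ioc b (b + N)) P z) ∧
    (((siftedSet A a N).card : ℝ) ≤ N * ∏ p ∈ A, (1 - 1 / (p : ℝ)) - δ * N →
      ∃ b, (siftedCount (Ioc b (b + N)) P z : ℝ) ≤ (1 - δ) * (N * sieveDensity P z)) := by
  have hQ : ∀ p ∈ elementsUpTo P z, p.Prime := fun p hp => hP p ((mem_elementsUpTo hz).1 hp).1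
  have h := exists_siftedSet_union (fun p hp => hQ p (hA hp))
    (fun p hp => hQ p (mem_sdiff.1 hp).1) (disjoint_sdiff (s := A) (t := elementsUpTo P z)) a N
  rw [union_sdiff_of_subset hA] at h
  simp only [siftedCount_eq P hz]
  have hdens : sieveDensity P z
      = (∏ p ∈ elementsUpTo P z \ A, (1 - 1 / (p : ℝ))) * ∏ p ∈ A, (1 - 1 / (p : ℝ)) :=
    (prod_sdiff hA).symm
  have hR0 : 0 ≤ ∏ p ∈ elementsUpTo P z \ A, (1 - 1 / (p : ℝ)) :=
    prod_nonneg fun p _ => one_sub_recip_nonneg p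
  have hA1 : ∏ p ∈ A, (1 - 1 / (p : ℝ)) ≤ 1 :=
    prod_le_one (fun p _ => one_sub_recip_nonneg p) fun p _ => by
      have : (0 : ℝ) ≤ 1 / p := by positivity
      linarith
  rw [hdens]
  set ρ := ∏ p ∈ A, (1 - 1 / (p : ℝ))
  set r := ∏ p ∈ elementsUpTo P z \ A, (1 - 1 / (p : ℝ))
  have hN : (0 : ℝ) ≤ N := Nat.cast_nonneg N
  have h1 : δ * N * r * ρ ≤ δ * N * r * 1 := by gcongr
  constructor
  · intro hc
    obtain ⟨b, hb⟩ := h.1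
    refine ⟨b, le_trans ?_ hb⟩
    have := mul_le_mul_of_nonneg_right hc hR0
    linarith
  · intro hc
    obtain ⟨b, hb⟩ := h.2
    refine ⟨b, hb.trans ?_⟩
    have := mul_le_mul_of_nonneg_right hc hR0
    linarith

/-- A family of disjoint sets of primes in `P ∩ [w, z]` yields intervals of length between `z ^ u`
and `z ^ (u + 2)` that contain too many, respectively too few, sifted integers. -/
lemma exists_intervals_of_family {P : Set ℕ} (hP : ∀ p ∈ P, p.Prime) {w z u d δ : ℝ} (hz : 2 ≤ z)
    (hw : 1 ≤ w) (Gs : List (Finset ℕ)) (hGs : ∀ G ∈ Gs, ∀ p ∈ G, p ∈ P ∧ w ≤ p ∧ p ≤ z)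
    (hd : Gs.Pairwise Disjoint) (hu : 0 ≤ u) (hxw : 2 * z ^ (u + 1) < w ^ Gs.length)
    (hsum : (Gs.map recipSum).sum ≤ 1 / 4) (hd0 : 0 < d) (hdz : 1 ≤ d * z ^ u)
    (hdΛ : d * (8 * 2 ^ Gs.length) ≤ (Gs.map recipSum).prod) (hδ : 0 ≤ δ) (hδd : δ ≤ d / 2) :
    (∃ a N : ℕ, z ^ u ≤ N ∧ (N : ℝ) ≤ z ^ (u + 2) ∧
      (1 + δ) * (N * sieveDensity P z) ≤ siftedCount (Ioc a (a + N)) P z) ∧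
    (∃ a N : ℕ, z ^ u ≤ N ∧ (N : ℝ) ≤ z ^ (u + 2) ∧
      (siftedCount (Ioc a (a + N)) P z : ℝ) ≤ (1 - δ) * (N * sieveDensity P z)) := by
  have hz0 : 0 < z := by linarith
  have hzu : 1 ≤ z ^ u := Real.one_le_rpow (by linarith) hu
  have e1 : z ^ (u + 1) = z ^ u * z := by rw [Real.rpow_add hz0, Real.rpow_one]
  have e2 : z ^ (u + 2) = z ^ u * z * z := by
    rw [show u + 2 = u + 1 + 1 by ring, Real.rpow_add hz0, e1, Real.rpow_one]
  have hYx : 2 * z ^ u ≤ 2 * z ^ (u + 1) := by rw [e1]; nlinarith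
  -- Here Y = 2z^u and x = 2z^(u+1) = Yz. The factor 2 keeps ⌊y⌋ ≥ z^u, and z ≥ 2 gives x ≤ z^(u+2).
  have key : ∀ s : ℝ, s = 1 ∨ s = -1 → ∃ A ⊆ elementsUpTo P z, ∃ y, 2 * z ^ u ≤ y ∧
      y ≤ 2 * z ^ (u + 1) ∧ d * y ≤ s * siftError A y := by
    intro s hs
    obtain ⟨A, hA, h⟩ := exists_le_mul_siftError hw Gs
      (fun G hG p hp => ⟨hP p (hGs G hG p hp).1, (hGs G hG p hp).2⟩) hd (by positivity) hxw hsum hs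
      (by positivity) hYx (by rw [e1, mul_assoc]) hd0 (by nlinarith) hdΛ
    refine ⟨A, fun p hp => (mem_elementsUpTo hz0.le).2 ?_, h⟩
    obtain ⟨G, hG, hpG⟩ := unionList_mem.1 (hA hp)
    exact ⟨(hGs G hG p hpG).1, (hGs G hG p hpG).2.2⟩
  have hfl : ∀ y : ℝ, 2 * z ^ u ≤ y → y ≤ 2 * z ^ (u + 1) →
      z ^ u ≤ (⌊y⌋₊ : ℝ) ∧ (⌊y⌋₊ : ℝ) ≤ z ^ (u + 2) ∧ (⌊y⌋₊ : ℝ) ≤ y ∧ y ≤ ⌊y⌋₊ + 1 := by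
    intro y h1 h2
    have h3 := Nat.floor_le (show 0 ≤ y by linarith)
    have h4 := (Nat.lt_floor_add_one y).le
    refine ⟨by linarith, h3.trans (h2.trans ?_), h3, h4⟩
    rw [e2, e1, mul_comm]
    gcongr
  have hρ : ∀ A : Finset ℕ, 0 ≤ ∏ p ∈ A, (1 - 1 / (p : ℝ)) ∧ ∏ p ∈ A, (1 - 1 / (p : ℝ)) ≤ 1 :=
    fun A => ⟨prod_nonneg fun p _ => one_sub_recip_nonneg p,
      prod_le_one (fun p _ => one_sub_recip_nonneg p) fun p _ => by
        have : (0 : ℝ) ≤ 1 / p := by positivity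
        linarith⟩
  constructor
  · obtain ⟨A, hA, y, h1, h2, h3⟩ := key 1 (Or.inl rfl)
    obtain ⟨f1, f2, f3, f4⟩ := hfl y h1 h2
    obtain ⟨b, hb⟩ := (exists_siftedCount hP hz0.le hδ hA 0 ⌊y⌋₊).1 (by
      rw [one_mul, siftError] at h3
      have h4 := mul_le_mul_of_nonneg_right f3 (hρ A).1
      have h5 : δ * ⌊y⌋₊ ≤ d * y := mul_le_mul (by linarith) f3 (by positivity) hd0.le
      linarith)
    exact ⟨b, _, f1, f2, hb⟩
  · obtain ⟨A, hA, y, h1, h2, h3⟩ := key (-1) (Or.inr rfl)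
    obtain ⟨f1, f2, f3, f4⟩ := hfl y h1 h2
    obtain ⟨b, hb⟩ := (exists_siftedCount hP hz0.le hδ hA 0 ⌊y⌋₊).2 (by
      rw [siftError] at h3
      -- Rounding y down costs at most 1 ≤ (d/2)y; the other half of d remains for δ.
      have h4 : y * ∏ p ∈ A, (1 - 1 / (p : ℝ)) ≤ (⌊y⌋₊ + 1) * ∏ p ∈ A, (1 - 1 / (p : ℝ)) :=
        mul_le_mul_of_nonneg_right f4 (hρ A).1
      have h5 : δ * ⌊y⌋₊ ≤ d / 2 * y := mul_le_mul hδd f3 (by positivity) (by positivity)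
      have h6 := (hρ A).2
      have h7 : 1 ≤ d / 2 * y := by nlinarith
      linarith)
    exact ⟨b, _, f1, f2, hb⟩

/-! ### Reciprocal sums over P from Chebyshev's bounds. -/

open Filter Chebyshev in
lemma exists_primeCounting_bounds : ∃ Y₀ : ℝ, 2 ≤ Y₀ ∧ ∀ y : ℝ, Y₀ ≤ y →
    1 / 2 * (y / Real.log y) ≤ Nat.primeCounting ⌊y⌋₊ ∧
    (Nat.primeCounting ⌊y⌋₊ : ℝ) ≤ 4 * (y / Real.log y) := by
  have h1 : ∀ᶠ y : ℝ in atTop, Real.log (y + 2) ≤ 1 / 100 * y := by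
    have := (Real.isLittleO_log_id_atTop.comp_tendsto
      (tendsto_atTop_add_const_right atTop (2 : ℝ) tendsto_id)).bound
      (show (0 : ℝ) < 1 / 200 by norm_num)
    filter_upwards [this, eventually_ge_atTop 2] with y hy hy2
    simp only [Function.comp, id, Real.norm_eq_abs] at hy
    rw [abs_of_nonneg (show (0 : ℝ) ≤ y + 2 by linarith)] at hy
    have := le_abs_self (Real.log (y + 2))
    linarith
  have h2 := eventually_primeCounting_le (ε := 1) one_pos
  obtain ⟨Y, hY⟩ := eventually_atTop.1 (h1.and h2)
  refine ⟨max Y 10, le_max_of_le_right (by norm_num), fun y hy => ?_⟩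
  obtain ⟨h1, h2⟩ := hY y ((le_max_left _ _).trans hy)
  have hy10 : 10 ≤ y := (le_max_right _ _).trans hy
  have hlog : 0 < Real.log y := Real.log_pos (by linarith)
  have hl2 := Real.log_two_gt_d9
  have hl2' := Real.log_two_lt_d9
  constructor
  · refine le_trans ?_ (pi_ge' (show 1 < y by linarith))
    rw [← mul_div_assoc]
    gcongr
    nlinarith
  · refine h2.trans ?_
    rw [← mul_div_assoc]
    gcongr
    rw [show (4 : ℝ) = 2 ^ 2 by norm_num, Real.log_pow]
    push_cast
    linarith

lemma ncard_eq_card_elementsUpTo (P : Set ℕ) {y : ℝ} (hy : 0 ≤ y) :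
    Set.ncard {p : ℕ | p ∈ P ∧ (p : ℝ) ≤ y} = (elementsUpTo P y).card := by
  rw [← Set.ncard_coe_finset]
  congr 1
  ext p
  simp [mem_elementsUpTo hy]

lemma card_elementsUpTo_le {P : Set ℕ} (hP : ∀ p ∈ P, p.Prime) {y : ℝ} (hy : 0 ≤ y) :
    (elementsUpTo P y).card ≤ Nat.primeCounting ⌊y⌋₊ := by
  rw [← Nat.primesLE_card_eq_primeCounting]
  refine card_le_card fun p hp => ?_
  rw [mem_elementsUpTo hy] at hp
  rw [Nat.mem_primesLE]
  exact ⟨Nat.le_floor hp.2, hP p hp.1⟩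

lemma elementsUpTo_mono (P : Set ℕ) {y y' : ℝ} (hy : 0 ≤ y) (h : y ≤ y') :
    elementsUpTo P y ⊆ elementsUpTo P y' := fun p hp => by
  rw [mem_elementsUpTo hy] at hp
  exact (mem_elementsUpTo (hy.trans h)).2 ⟨hp.1, hp.2.trans h⟩

/-- Since R ≥ 32/κ, π(Y/R) is at most (κ/4)Y/log Y, half of the lower bound for the elements of P up
to Y. What is left in (Y/R, Y] contributes at least 1/Y per element. -/
lemma recipSum_block_ge {P : Set ℕ} (hP : ∀ p ∈ P, p.Prime) {κ z R Y₀ : ℝ}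
    (hY₀ : ∀ y : ℝ, Y₀ ≤ y → 1 / 2 * (y / Real.log y) ≤ Nat.primeCounting ⌊y⌋₊ ∧
      (Nat.primeCounting ⌊y⌋₊ : ℝ) ≤ 4 * (y / Real.log y))
    (hκ : 0 < κ) (hR : 1 < R) (hRκ : 32 ≤ R * κ) (hz : 1 < z) (hz₀ : Y₀ ≤ √z)
    (h : HasPrimeProportion P κ z) {Y : ℝ} (hYz : Y ≤ z) (hY : √z ≤ Y / R) :
    κ / (4 * Real.log z) ≤ recipSum (elementsUpTo P Y \ elementsUpTo P (Y / R)) := by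
  have hs1 : 1 < √z := by rw [Real.lt_sqrt] <;> linarith
  have hR0 : 0 < R := by linarith
  have hsY : √z < Y := by
    rw [le_div_iff₀ hR0] at hY
    nlinarith
  have hY0 : 0 < Y := by linarith
  have hlz : 0 < Real.log z := Real.log_pos hz
  have hlY : 0 < Real.log Y := Real.log_pos (by linarith)
  have hlYz : Real.log Y ≤ Real.log z := Real.log_le_log hY0 hYz
  have hlYR : 1 / 2 * Real.log Y ≤ Real.log (Y / R) := by
    have := Real.log_le_log (by linarith) hY
    rw [Real.log_sqrt (by linarith)] at this
    linarith
  have hYR0 : 0 ≤ Y / R := by positivity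
  have hc1 := h Y hsY hYz
  rw [ncard_eq_card_elementsUpTo P hY0.le] at hc1
  have hc2 : ((elementsUpTo P (Y / R)).card : ℝ) ≤ Nat.primeCounting ⌊Y / R⌋₊ := by
    exact_mod_cast card_elementsUpTo_le hP hYR0
  have hb1 := (hY₀ Y (hz₀.trans hsY.le)).1
  have hb2 := (hY₀ (Y / R) (hz₀.trans hY)).2
  have hb3 : 4 * (Y / R / Real.log (Y / R)) ≤ κ / 4 * (Y / Real.log Y) := by
    calc 4 * (Y / R / Real.log (Y / R)) ≤ 4 * (Y / R / (1 / 2 * Real.log Y)) := by gcongr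
      _ = 8 / R * (Y / Real.log Y) := by field_simp; norm_num
      _ ≤ κ / 4 * (Y / Real.log Y) := by
        have : 8 / R ≤ κ / 4 := by rw [div_le_div_iff₀ hR0 (by norm_num)]; linarith
        gcongr
  have hsub := elementsUpTo_mono P hYR0 (div_le_self hY0.le hR.le)
  have hcard : κ / 4 * (Y / Real.log Y)
      ≤ (elementsUpTo P Y \ elementsUpTo P (Y / R)).card := by
    rw [card_sdiff_of_subset hsub, Nat.cast_sub (card_le_card hsub)]
    have := mul_le_mul_of_nonneg_left hb1 hκ.le
    linarith
  calc κ / (4 * Real.log z) ≤ κ / (4 * Real.log Y) := by gcongr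
    _ = κ / 4 * (Y / Real.log Y) * (1 / Y) := by field_simp
    _ ≤ (elementsUpTo P Y \ elementsUpTo P (Y / R)).card * (1 / Y) := by gcongr
    _ ≤ _ := by
      rw [← nsmul_eq_mul, recipSum]
      refine card_nsmul_le_sum _ _ _ fun p hp => ?_
      obtain ⟨hpP, hpY⟩ := (mem_elementsUpTo hY0.le).1 (mem_sdiff.1 hp).1
      have : (0 : ℝ) < p := by exact_mod_cast (hP p hpP).pos
      gcongr

lemma recipSum_blocks_ge {P : Set ℕ} (hP : ∀ p ∈ P, p.Prime) {κ z R Y₀ : ℝ}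
    (hY₀ : ∀ y : ℝ, Y₀ ≤ y → 1 / 2 * (y / Real.log y) ≤ Nat.primeCounting ⌊y⌋₊ ∧
      (Nat.primeCounting ⌊y⌋₊ : ℝ) ≤ 4 * (y / Real.log y))
    (hκ : 0 < κ) (hR : 1 < R) (hRκ : 32 ≤ R * κ) (hz : 1 < z) (hz₀ : Y₀ ≤ √z)
    (h : HasPrimeProportion P κ z) (k : ℕ) (hk : √z ≤ z / R ^ k) :
    k * (κ / (4 * Real.log z)) ≤ recipSum (elementsUpTo P z \ elementsUpTo P (z / R ^ k)) := by
  have hR0 : 0 < R := by linarith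
  have hz0 : 0 < z := by linarith
  induction k with
  | zero => simpa using recipSum_nonneg _
  | succ k ih =>
    have e : z / R ^ (k + 1) = z / R ^ k / R := by rw [pow_succ, div_div]
    have hpos : 0 < z / R ^ k := by positivity
    have hle : z / R ^ (k + 1) ≤ z / R ^ k := by rw [e]; exact div_le_self hpos.le hR.le
    have hle' : z / R ^ k ≤ z := div_le_self hz0.le (one_le_pow₀ hR.le)
    have h1 := ih (hk.trans hle)
    have h2 := recipSum_block_ge hP hY₀ hκ hR hRκ hz hz₀ h hle' (by rwa [← e])
    rw [← e] at h2
    have hsub1 := elementsUpTo_mono P (show 0 ≤ z / R ^ (k + 1) by positivity) hle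
    have hsub2 := elementsUpTo_mono P hpos.le hle'
    have e1 : recipSum (elementsUpTo P z \ elementsUpTo P (z / R ^ k))
        + recipSum (elementsUpTo P (z / R ^ k)) = recipSum (elementsUpTo P z) := sum_sdiff hsub2
    have e2 : recipSum (elementsUpTo P (z / R ^ k) \ elementsUpTo P (z / R ^ (k + 1)))
        + recipSum (elementsUpTo P (z / R ^ (k + 1))) = recipSum (elementsUpTo P (z / R ^ k)) :=
      sum_sdiff hsub1
    have e3 : recipSum (elementsUpTo P z \ elementsUpTo P (z / R ^ (k + 1)))
        + recipSum (elementsUpTo P (z / R ^ (k + 1))) = recipSum (elementsUpTo P z) :=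
      sum_sdiff (hsub1.trans hsub2)
    push_cast
    linarith

/-- A set of primes of positive proportion has reciprocal sum `≫ η` on `[z ^ (1 - η), z]`. -/
lemma exists_recipSum_ge {κ : ℝ} (hκ : 0 < κ) : ∃ C k z₀ : ℝ, 0 < C ∧ 0 < k ∧ k ≤ 1 ∧
    ∀ z : ℝ, z₀ ≤ z → ∀ P : Set ℕ, (∀ p ∈ P, p.Prime) → HasPrimeProportion P κ z →
      ∀ η : ℝ, 0 < η → η ≤ 1 / 2 → C ≤ η * Real.log z →
        ∃ S : Finset ℕ, (∀ p ∈ S, p ∈ P ∧ z ^ (1 - η) ≤ p ∧ p ≤ z) ∧ k * η ≤ recipSum S := by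
  obtain ⟨Y₀, hY₀2, hY₀⟩ := exists_primeCounting_bounds
  set R : ℝ := 32 / κ + 2
  have hR : 1 < R := by
    have : 0 < 32 / κ := by positivity
    simp only [R]
    linarith
  have hRκ : 32 ≤ R * κ := by
    simp only [R, add_mul, div_mul_cancel₀ _ hκ.ne']
    linarith
  have hlR : 0 < Real.log R := Real.log_pos hR
  refine ⟨Real.log R, min 1 (κ / (8 * Real.log R)), Y₀ ^ 2, hlR, by positivity, min_le_left _ _, ?_⟩
  intro z hz P hP h η hη hη2 hC
  have hz₀ : Y₀ ≤ √z := Real.le_sqrt_of_sq_le hz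
  have hz1 : 1 < z := by nlinarith
  have hz0 : 0 < z := by linarith
  have hlz : 0 < Real.log z := Real.log_pos hz1
  have ht : 1 ≤ η * Real.log z / Real.log R := by rwa [one_le_div hlR]
  -- The number of blocks of ratio R that fit into [z^(1-η), z]; as the quotient is at least 1,
  -- rounding down loses at most half.
  set k := ⌊η * Real.log z / Real.log R⌋₊
  have hk1 : (k : ℝ) ≤ η * Real.log z / Real.log R := Nat.floor_le (by linarith)
  have hk2 : η * Real.log z / Real.log R / 2 ≤ k := by
    have h1 : (1 : ℝ) ≤ k := by exact_mod_cast (Nat.one_le_floor_iff _).2 ht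
    have h2 := Nat.lt_floor_add_one (η * Real.log z / Real.log R)
    linarith
  have hRk : R ^ k ≤ z ^ η := by
    rw [le_div_iff₀ hlR] at hk1
    rw [← Real.log_le_log_iff (by positivity) (by positivity), Real.log_pow, Real.log_rpow hz0]
    exact hk1
  have hw : z ^ (1 - η) ≤ z / R ^ k := by
    rw [Real.rpow_sub hz0, Real.rpow_one]
    gcongr
  have hsw : √z ≤ z ^ (1 - η) := by
    rw [Real.sqrt_eq_rpow]
    exact Real.rpow_le_rpow_of_exponent_le hz1.le (by linarith)
  refine ⟨_, fun p hp => ?_,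
    le_trans ?_ (recipSum_blocks_ge hP hY₀ hκ hR hRκ hz1 hz₀ h k (hsw.trans hw))⟩
  · rw [mem_sdiff, mem_elementsUpTo hz0.le, mem_elementsUpTo (by positivity)] at hp
    obtain ⟨⟨hpP, hpz⟩, hn⟩ := hp
    refine ⟨hpP, hw.trans ?_, hpz⟩
    by_contra hlt
    exact hn ⟨hpP, (not_le.1 hlt).le⟩
  · calc min 1 (κ / (8 * Real.log R)) * η ≤ κ / (8 * Real.log R) * η := by
          gcongr; exact min_le_right _ _
      _ = η * Real.log z / Real.log R / 2 * (κ / (4 * Real.log z)) := by field_simp; norm_num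
      _ ≤ _ := by gcongr

/-! ### Choice of η and of the number of groups. -/

lemma log_add_two_le {u₀ u C : ℝ} (hu₀ : 1 < u₀) (hC : 0 ≤ C) (hu : u₀ ≤ u) :
    C + Real.log (u + 2) ≤ ((C + Real.log 3) / Real.log u₀ + 1) * Real.log u := by
  have h0 : 0 < Real.log u₀ := Real.log_pos hu₀
  have h1 : Real.log u₀ ≤ Real.log u := Real.log_le_log (by linarith) hu
  have h3 : 0 ≤ Real.log 3 := Real.log_nonneg (by norm_num)
  have h2 : Real.log (u + 2) ≤ Real.log 3 + Real.log u := by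
    rw [← Real.log_mul (by norm_num) (by linarith)]
    exact Real.log_le_log (by linarith) (by linarith)
  have h4 : C + Real.log 3 ≤ (C + Real.log 3) / Real.log u₀ * Real.log u := by
    rw [div_mul_eq_mul_div, le_div_iff₀ h0]
    gcongr
  linarith

/-- Bounds for the number of groups `⌈(u + 2) / (1 - η)⌉`. -/
lemma ceil_div_bounds {u η : ℝ} (hu : 1 ≤ u) (hη : 0 < η) (hη4 : η ≤ 1 / 4) :
    (u + 2 ≤ (1 - η) * ⌈(u + 2) / (1 - η)⌉₊) ∧
    ((⌈(u + 2) / (1 - η)⌉₊ : ℝ) ≤ u + (2 * η * u + 4)) ∧ (1 : ℝ) ≤ ⌈(u + 2) / (1 - η)⌉₊ := by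
  have h1 : 0 < 1 - η := by linarith
  have hc := Nat.le_ceil ((u + 2) / (1 - η))
  have h2 : u + 2 ≤ (1 - η) * ⌈(u + 2) / (1 - η)⌉₊ := by
    rw [div_le_iff₀ h1] at hc
    linarith
  have h3 : (⌈(u + 2) / (1 - η)⌉₊ : ℝ) < (u + 2) / (1 - η) + 1 := Nat.ceil_lt_add_one (by positivity)
  have h4 : (u + 2) / (1 - η) ≤ (u + 2) * (1 + 2 * η) := by
    rw [div_le_iff₀ h1]
    nlinarith [mul_nonneg (show 0 ≤ u + 2 by linarith) (mul_nonneg hη.le (show 0 ≤ 1 - 2 * η by linarith))]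
  refine ⟨h2, by nlinarith, ?_⟩
  have : u + 2 ≤ (u + 2) / (1 - η) := le_div_self (by linarith) h1 (by linarith)
  linarith

/-- The exponent J exceeds u by at most 2ηu + 4. The base is at most V with log V = O(log(u+2)), and
η log(u+2) ≤ C, so the excess power of V is e^(O(u)) and goes into D. The 4C in the denominator
keeps η ≤ 1/4. -/
lemma exists_pow_bound {C k u₀ : ℝ} (hC : 0 < C) (hk : 0 < k) (hk1 : k ≤ 1) (hu₀ : 1 < u₀) :
    ∃ D : ℝ, 0 < D ∧ ∀ u η : ℝ, ∀ J : ℕ, u₀ ≤ u → η = C / (4 * C + Real.log (u + 2)) →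
      J = ⌈(u + 2) / (1 - η)⌉₊ → 32 * J / (k * η) ≤ D * (u * Real.log u) ∧
        (32 * J / (k * η)) ^ J ≤ (D * (u * Real.log u)) ^ u := by
  have hlu₀ : 0 < Real.log u₀ := Real.log_pos hu₀
  have hl3 : 0 < Real.log 3 := Real.log_pos (by norm_num)
  set D₁ : ℝ := 192 * ((4 * C + Real.log 3) / Real.log u₀ + 1) / (k * C) with hD₁
  have hD₁0 : 0 < D₁ := by positivity
  set D₂ : ℝ := |Real.log D₁| + 2 with hD₂
  have hD₂0 : 0 < D₂ := by positivity
  refine ⟨D₁ * Real.exp ((2 * C + 8) * D₂), by positivity, ?_⟩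
  intro u η J hu hη hJ
  have hu1 : 1 < u := hu₀.trans_le hu
  have hlu : 0 < Real.log u := Real.log_pos hu1
  have hL1 : 1 ≤ Real.log (u + 2) := by
    rw [Real.le_log_iff_exp_le (by linarith)]
    have := Real.exp_one_lt_d9
    linarith
  have hL2 : Real.log (u + 2) ≤ 2 * u := by
    have := Real.log_le_sub_one_of_pos (show 0 < u + 2 by linarith)
    linarith
  set L := Real.log (u + 2)
  have hη0 : 0 < η := by rw [hη]; positivity
  have hη4 : η ≤ 1 / 4 := by
    rw [hη, div_le_div_iff₀ (by positivity) (by norm_num)]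
    linarith
  have hηL : η * L ≤ C := by
    rw [hη, div_mul_eq_mul_div, div_le_iff₀ (by positivity)]
    nlinarith
  obtain ⟨-, hJ2, hJ1⟩ := ceil_div_bounds hu1.le hη0 hη4
  rw [← hJ] at hJ2 hJ1
  have hJ6 : (J : ℝ) ≤ 6 * u := by nlinarith
  have hX : 32 * J / (k * η) ≤ D₁ * (u * Real.log u) := by
    have h1 : 32 * J / (k * η) = 32 * J * (4 * C + L) / (k * C) := by
      rw [hη]; field_simp
    rw [h1, hD₁, div_mul_eq_mul_div]
    have h2 := log_add_two_le hu₀ (show 0 ≤ 4 * C by positivity) hu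
    refine div_le_div_of_nonneg_right ?_ (by positivity)
    calc 32 * J * (4 * C + L) ≤ 32 * (6 * u) *
          (((4 * C + Real.log 3) / Real.log u₀ + 1) * Real.log u) := by gcongr
      _ = _ := by ring
  have hX1 : 1 ≤ 32 * J / (k * η) := by
    rw [one_le_div (by positivity)]
    have : k * η ≤ 1 * (1 / 4) := by gcongr
    linarith
  set V := D₁ * (u * Real.log u) with hV
  have hV1 : 1 ≤ V := hX1.trans hX
  have hlV : Real.log V ≤ D₂ * L := by
    have h1 : Real.log V = Real.log D₁ + (Real.log u + Real.log (Real.log u)) := by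
      rw [hV, Real.log_mul hD₁0.ne' (by positivity), Real.log_mul (by linarith) hlu.ne']
    have h2 : Real.log u ≤ L := Real.log_le_log (by linarith) (by linarith)
    have h3 : Real.log (Real.log u) ≤ L := by
      refine Real.log_le_log hlu ?_
      have := Real.log_le_sub_one_of_pos (show 0 < u by linarith)
      linarith
    have h4 := le_abs_self (Real.log D₁)
    have h5 : |Real.log D₁| * 1 ≤ |Real.log D₁| * L := by gcongr
    rw [h1, hD₂]
    linarith
  have hE : 1 ≤ Real.exp ((2 * C + 8) * D₂) := Real.one_le_exp (by positivity)
  have e : D₁ * Real.exp ((2 * C + 8) * D₂) * (u * Real.log u)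
      = V * Real.exp ((2 * C + 8) * D₂) := by rw [hV]; ring
  rw [e]
  refine ⟨hX.trans (le_mul_of_one_le_right (by linarith) hE), ?_⟩
  calc (32 * J / (k * η)) ^ J ≤ V ^ J := by gcongr
    _ = V ^ (J : ℝ) := (Real.rpow_natCast V J).symm
    _ ≤ V ^ (u + (2 * η * u + 4)) := Real.rpow_le_rpow_of_exponent_le hV1 hJ2
    _ = V ^ u * Real.exp (Real.log V * (2 * η * u + 4)) := by
      rw [Real.rpow_add (by linarith), Real.rpow_def_of_pos (show 0 < V by linarith) (2 * η * u + 4)]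
    _ ≤ V ^ u * Real.exp ((2 * C + 8) * D₂ * u) := by
      refine mul_le_mul_of_nonneg_left (Real.exp_le_exp.2 ?_) (by positivity)
      calc Real.log V * (2 * η * u + 4) ≤ D₂ * L * (2 * η * u + 4) := by gcongr
        _ = 2 * D₂ * u * (η * L) + 4 * D₂ * L := by ring
        _ ≤ 2 * D₂ * u * C + 4 * D₂ * (2 * u) := by gcongr
        _ = (2 * C + 8) * D₂ * u := by ring
    _ = (V * Real.exp ((2 * C + 8) * D₂)) ^ u := by
      rw [Real.mul_rpow (by linarith) (Real.exp_pos _).le, Real.exp_mul]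

/-- Since 3/4 ≤ 1 - η, this ensures 1/p ≤ g for the primes p ≥ z^(1-η) to be grouped. The bounds log
u ≤ 4u^(1/4) and u ≤ K√z give z^(5/8); the spare z^(1/8) absorbs the constants. -/
lemma exists_mul_log_le {D K : ℝ} (hD : 0 < D) (hK : 0 < K) : ∃ z₀ : ℝ, ∀ z u : ℝ, z₀ ≤ z →
    1 ≤ z → 1 < u → u ≤ K * √z → D * (u * Real.log u) ≤ z ^ (3 / 4 : ℝ) := by
  refine ⟨(D * 4 * K ^ (5 / 4 : ℝ)) ^ 8, fun z u hz hz1 hu huK => ?_⟩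
  have hz0 : 0 < z := by linarith
  have h1 : Real.log u ≤ u ^ (1 / 4 : ℝ) / (1 / 4) := Real.log_le_rpow_div (by linarith) (by norm_num)
  have h2 : D * 4 * K ^ (5 / 4 : ℝ) ≤ z ^ (1 / 8 : ℝ) := by
    have : D * 4 * K ^ (5 / 4 : ℝ) = ((D * 4 * K ^ (5 / 4 : ℝ)) ^ 8) ^ (1 / 8 : ℝ) := by
      rw [← Real.rpow_natCast, ← Real.rpow_mul (by positivity)]
      norm_num
    rw [this]
    exact Real.rpow_le_rpow (by positivity) hz (by norm_num)
  calc D * (u * Real.log u) ≤ D * (u * (u ^ (1 / 4 : ℝ) / (1 / 4))) := by gcongr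
    _ = D * 4 * u ^ (5 / 4 : ℝ) := by
      rw [show (5 / 4 : ℝ) = 1 + 1 / 4 by norm_num, Real.rpow_add (by linarith), Real.rpow_one]
      ring
    _ ≤ D * 4 * (K * √z) ^ (5 / 4 : ℝ) := by gcongr
    _ = D * 4 * K ^ (5 / 4 : ℝ) * z ^ (5 / 8 : ℝ) := by
      rw [Real.mul_rpow hK.le (Real.sqrt_nonneg z), Real.sqrt_eq_rpow, ← Real.rpow_mul hz0.le]
      norm_num
      ring
    _ ≤ z ^ (1 / 8 : ℝ) * z ^ (5 / 8 : ℝ) := by gcongr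
    _ = z ^ (3 / 4 : ℝ) := by rw [← Real.rpow_add hz0]; norm_num

/-! ### Large z. -/

/-- The intervals for large `z`. -/
lemma exists_intervals_of_large {κ K u₀ : ℝ} (hκ : 0 < κ) (hK : 0 < K) (hu₀ : 1 < u₀) :
    ∃ c₁ z₀ : ℝ, 0 < c₁ ∧ ∀ c z : ℝ, 0 < c → c ≤ c₁ → z₀ ≤ z → ∀ P : Set ℕ, (∀ p ∈ P, p.Prime) →
      HasPrimeProportion P κ z → ∀ u : ℝ, u₀ ≤ u → u ≤ K * √z →
      (∃ a N : ℕ, z ^ u ≤ N ∧ (N : ℝ) ≤ z ^ (u + 2) ∧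
        (1 + (c / (u * Real.log u)) ^ u) * (N * sieveDensity P z)
          ≤ siftedCount (Ioc a (a + N)) P z) ∧
      (∃ a N : ℕ, z ^ u ≤ N ∧ (N : ℝ) ≤ z ^ (u + 2) ∧
        (siftedCount (Ioc a (a + N)) P z : ℝ)
          ≤ (1 - (c / (u * Real.log u)) ^ u) * (N * sieveDensity P z)) := by
  obtain ⟨C, k, z₁, hC, hk, hk1, hS⟩ := exists_recipSum_ge hκ
  obtain ⟨D, hD, hpow⟩ := exists_pow_bound hC hk hk1 hu₀
  obtain ⟨z₂, hz₂⟩ := exists_mul_log_le hD hK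
  refine ⟨1 / (2 * D), max (max z₁ z₂) (max 3 (Real.exp (2 * (4 * C + Real.log (K + 2))))),
    by positivity, ?_⟩
  intro c z hc hcD hz P hP hprop u hu huK
  simp only [max_le_iff] at hz
  obtain ⟨⟨hz1, hz2⟩, hz3, hz4⟩ := hz
  have hu1 : 1 < u := hu₀.trans_le hu
  have hlu : 0 < Real.log u := Real.log_pos hu1
  have hz0 : 0 < z := by linarith
  have hDz := hz₂ z u hz2 (by linarith) hu1 huK
  have hL1 : 0 < Real.log (u + 2) := Real.log_pos (by linarith)
  obtain ⟨η, hη⟩ : ∃ η, η = C / (4 * C + Real.log (u + 2)) := ⟨_, rfl⟩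
  obtain ⟨J, hJ⟩ : ∃ J, J = ⌈(u + 2) / (1 - η)⌉₊ := ⟨_, rfl⟩
  obtain ⟨hX, hXJ⟩ := hpow u η J hu hη hJ
  have hη0 : 0 < η := by rw [hη]; positivity
  have hη4 : η ≤ 1 / 4 := by
    rw [hη, div_le_div_iff₀ (by positivity) (by norm_num)]
    linarith
  obtain ⟨hJu, -, hJ1⟩ := ceil_div_bounds hu1.le hη0 hη4
  rw [← hJ] at hJu hJ1
  -- Equivalent to 4C + log(u+2) ≤ log z: u ≤ K√z leaves half of log z for the constants.
  have hηz : C ≤ η * Real.log z := by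
    have h1 : Real.log (u + 2) ≤ Real.log (K + 2) + 1 / 2 * Real.log z := by
      have h2 : 1 ≤ √z := Real.one_le_sqrt.2 (by linarith)
      rw [show 1 / 2 * Real.log z = Real.log √z by rw [Real.log_sqrt hz0.le]; ring,
        ← Real.log_mul (by positivity) (by positivity)]
      exact Real.log_le_log (by linarith) (by linarith)
    rw [← Real.le_log_iff_exp_le hz0] at hz4
    rw [hη, div_mul_eq_mul_div, le_div_iff₀ (by positivity)]
    gcongr
    linarith
  obtain ⟨S, hSw, hSsum⟩ := hS z hz1 P hP hprop η hη0 (by linarith) hηz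
  -- J groups of sum at most 2g use up at most kη, the available reciprocal sum.
  set g := k * η / (2 * J) with hg
  have hg0 : 0 < g := by positivity
  have hgX : 32 * J / (k * η) = 16 / g := by rw [hg]; field_simp; norm_num
  rw [hgX] at hX hXJ
  have hw : z ^ (3 / 4 : ℝ) ≤ z ^ (1 - η) :=
    Real.rpow_le_rpow_of_exponent_le (by linarith) (by linarith)
  have hgw : 1 / g ≤ z ^ (1 - η) := by
    refine le_trans ?_ ((hX.trans hDz).trans hw)
    gcongr
    norm_num
  obtain ⟨Gs, hlen, hdis, hGs⟩ := exists_disjoint_family hg0.le J S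
    (fun p hp => by
      have h1 := hgw.trans (hSw p hp).2.1
      exact (one_div_le hg0 ((one_div_pos.2 hg0).trans_le h1)).1 h1)
    (by rw [show J * (2 * g) = k * η by rw [hg]; field_simp]; exact hSsum)
  have hsum : (Gs.map recipSum).sum ≤ 1 / 4 := by
    refine (listSum_le_of_forall_le fun G hG => (hGs G hG).2.2).trans ?_
    rw [hlen, show J * (2 * g) = k * η by rw [hg]; field_simp]
    calc k * η ≤ 1 * (1 / 4) := by gcongr
      _ = 1 / 4 := by norm_num
  have hprod := pow_le_listProd hg0.le fun G hG => (hGs G hG).2.1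
  rw [hlen] at hprod
  set W := D * (u * Real.log u) with hW
  have hW0 : 0 < W := by positivity
  have hWu : 0 < W ^ u := Real.rpow_pos_of_pos hW0 u
  have hWd : 1 / W ^ u * (8 * 2 ^ J) ≤ g ^ J := by
    have h1 : (8 : ℝ) ≤ 8 ^ J := le_self_pow₀ (by norm_num) (by
      rintro rfl; norm_num at hJ1)
    rw [div_pow, div_le_iff₀ (by positivity)] at hXJ
    rw [one_div, inv_mul_le_iff₀ hWu]
    refine le_trans ?_ hXJ
    calc (8 : ℝ) * 2 ^ J ≤ 8 ^ J * 2 ^ J := by gcongr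
      _ = 16 ^ J := by rw [← mul_pow]; norm_num
  have hWz : W ≤ z := hDz.trans (by
    conv_rhs => rw [← Real.rpow_one z]
    exact Real.rpow_le_rpow_of_exponent_le (by linarith) (by norm_num))
  -- The 2 in c ≤ 1/(2D) supplies the halving, because (1/2)^u ≤ 1/2.
  have hδ : (c / (u * Real.log u)) ^ u ≤ 1 / W ^ u / 2 := by
    have h1 : c / (u * Real.log u) ≤ 1 / 2 * (1 / W) := by
      rw [hW, div_le_iff₀ (by positivity)]
      refine hcD.trans (le_of_eq ?_)
      field_simp
    calc (c / (u * Real.log u)) ^ u ≤ (1 / 2 * (1 / W)) ^ u := by gcongr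
      _ = (1 / 2) ^ u * (1 / W ^ u) := by
        rw [Real.mul_rpow (by norm_num) (by positivity), Real.div_rpow zero_le_one hW0.le,
          Real.one_rpow]
      _ ≤ (1 / 2) ^ (1 : ℝ) * (1 / W ^ u) := by
        gcongr ?_ * _
        exact Real.rpow_le_rpow_of_exponent_ge (by norm_num) (by norm_num) hu1.le
      _ = 1 / W ^ u / 2 := by rw [Real.rpow_one]; ring
  refine exists_intervals_of_family hP (w := z ^ (1 - η)) (d := 1 / W ^ u) (by linarith)
    (Real.one_le_rpow (by linarith) (by linarith)) Gs
    (fun G hG p hp => hSw p ((hGs G hG).1 hp)) hdis (by linarith) ?_ hsum (by positivity) ?_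
    (by rw [hlen]; exact hWd.trans hprod) (by positivity) hδ
  · rw [hlen, ← Real.rpow_natCast, ← Real.rpow_mul hz0.le]
    calc 2 * z ^ (u + 1) < z * z ^ (u + 1) := by gcongr; linarith
      _ = z ^ (u + 2) := by
        rw [show u + 2 = 1 + (u + 1) by ring, Real.rpow_add hz0 1, Real.rpow_one]
      _ ≤ _ := Real.rpow_le_rpow_of_exponent_le (by linarith) hJu
  · rw [one_div, ← div_eq_inv_mul, one_le_div hWu]
    gcongr

/-! ### Bounded z, and the conclusion. -/

lemma siftedSet_card_add (A : Finset ℕ) (a N : ℕ) :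
    (siftedSet A 0 (a + N)).card = (siftedSet A 0 a).card + (siftedSet A a N).card := by
  rw [siftedSet, siftedSet, siftedSet, zero_add, zero_add,
    ← Ioc_union_Ioc_eq_Ioc (Nat.zero_le a) (Nat.le_add_right a N), filter_union,
    card_union_of_disjoint]
  exact disjoint_filter_filter (Ioc_disjoint_Ioc_of_le le_rfl)

lemma siftedSet_singleton_card {p : ℕ} (hp : p.Prime) (m : ℕ) :
    (siftedSet {p} 0 m).card + m / p = m := by
  have h := siftedSet_card_insert (A := ∅) (by simp) hp (by simp) m
  simpa [siftedSet] using h.symm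

lemma exists_mem_le_of_hasPrimeProportion {P : Set ℕ} {κ z : ℝ} (hκ : 0 < κ) (hz : 2 ≤ z)
    (h : HasPrimeProportion P κ z) : ∃ p ∈ P, (p : ℝ) ≤ z := by
  have h1 := h z (by rw [Real.sqrt_lt' (by linarith)]; nlinarith) le_rfl
  have h2 : (0 : ℝ) < Nat.primeCounting ⌊z⌋₊ := by
    have : 1 ≤ Nat.primeCounting ⌊z⌋₊ :=
      Nat.monotone_primeCounting (show 2 ≤ ⌊z⌋₊ from Nat.le_floor (by exact_mod_cast hz))
    exact_mod_cast this
  have h3 : (0 : ℝ) < Set.ncard {p : ℕ | p ∈ P ∧ (p : ℝ) ≤ z} :=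
    lt_of_lt_of_le (by positivity) h1
  obtain ⟨p, hp⟩ := Set.nonempty_of_ncard_ne_zero (by exact_mod_cast h3.ne')
  exact ⟨p, hp⟩

/-- Sifting by a single prime gives intervals with a deviation of at least `1 / 2`. -/
lemma exists_intervals_of_prime {P : Set ℕ} (hP : ∀ p ∈ P, p.Prime) {z δ : ℝ} {p : ℕ}
    (hp : p ∈ P) (hpz : p ≤ z) (T : ℕ) (hδ : 0 ≤ δ) (hδT : δ * (z * T + z) ≤ 1 / 2) :
    (∃ a N : ℕ, T ≤ N ∧
      (1 + δ) * (N * sieveDensity P z) ≤ siftedCount (Ioc a (a + N)) P z) ∧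
    (∃ a N : ℕ, T ≤ N ∧
      (siftedCount (Ioc a (a + N)) P z : ℝ) ≤ (1 - δ) * (N * sieveDensity P z)) := by
  have hpp := hP p hp
  have hp2 : (2 : ℝ) ≤ p := by exact_mod_cast hpp.two_le
  have hz0 : 0 ≤ z := by linarith
  have hA : ({p} : Finset ℕ) ⊆ elementsUpTo P z := by
    rw [singleton_subset_iff, mem_elementsUpTo hz0]
    exact ⟨hp, hpz⟩
  have hinv : 1 / (p : ℝ) ≤ 1 / 2 := by gcongr
  have hpT : (p : ℝ) * T + p ≤ z * T + z := by gcongr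
  have hT : T ≤ p * T := Nat.le_mul_of_pos_left T hpp.pos
  have hsub : ((p - 1 : ℕ) : ℝ) = p - 1 := by
    rw [Nat.cast_sub hpp.one_le, Nat.cast_one]
  constructor
  -- The interval stops just before a multiple of p, giving a surplus 1 - 1/p ≥ 1/2.
  · have hcard := siftedSet_singleton_card hpp (p * T + (p - 1))
    rw [Nat.mul_add_div hpp.pos, Nat.div_eq_of_lt (Nat.sub_lt hpp.pos one_pos), add_zero] at hcard
    have hcard' := congrArg (Nat.cast : ℕ → ℝ) hcard
    push_cast [hsub] at hcard'
    obtain ⟨b, hb⟩ := (exists_siftedCount hP hz0 hδ hA 0 (p * T + (p - 1))).1 (by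
      rw [prod_singleton]
      push_cast [hsub]
      have h1 : δ * (p * T + (p - 1)) ≤ δ * (z * T + z) := by gcongr; linarith
      have h2 : ((p : ℝ) * T + (p - 1)) * (1 - 1 / p) = p * T + (p - 1) - T - (1 - 1 / p) := by
        field_simp; ring
      rw [h2]
      linarith)
    exact ⟨b, _, by omega, hb⟩
  -- The interval starts and ends at a multiple of p, giving a deficit 1 - 1/p.
  · have hcard := siftedSet_card_add {p} (p - 1) (p * T + 1)
    have h1 := siftedSet_singleton_card hpp (p - 1)
    have h2 := siftedSet_singleton_card hpp (p - 1 + (p * T + 1))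
    rw [Nat.div_eq_of_lt (Nat.sub_lt hpp.pos one_pos), add_zero] at h1
    have e : p - 1 + (p * T + 1) = p * (T + 1) := by
      have := hpp.one_le
      rw [mul_add]; omega
    rw [e, Nat.mul_div_cancel_left _ hpp.pos] at h2
    rw [e, h1] at hcard
    rw [hcard] at h2
    have hcard' := congrArg (Nat.cast : ℕ → ℝ) h2
    push_cast [hsub] at hcard'
    obtain ⟨b, hb⟩ := (exists_siftedCount hP hz0 hδ hA (p - 1) (p * T + 1)).2 (by
      rw [prod_singleton]
      push_cast
      have h1 : δ * (p * T + 1) ≤ δ * (z * T + z) := by gcongr; linarith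
      have h2 : ((p : ℝ) * T + 1) * (1 - 1 / p) = p * T - T + (1 - 1 / p) := by
        field_simp
      rw [h2]
      linarith)
    exact ⟨b, _, by omega, hb⟩

theorem corollary1p1 (κ K u₀ : ℝ) (hκ : 0 < κ) (hK : 0 < K) (hu₀ : 1 < u₀) :
    ∃ c : ℝ, 0 < c ∧ ∀ ε : ℝ, 0 < ε → ∃ z₁ : ℝ,
      ∀ z : ℝ, 2 ≤ z → ∀ P : Set ℕ, (∀ p ∈ P, p.Prime) → HasPrimeProportion P κ z →
        ∀ u : ℝ, u₀ ≤ u → u ≤ K * √z →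
          (∃ a N : ℕ, z ^ u ≤ (N : ℝ) ∧
            (z₁ ≤ z →
              u ≤ (1 - ε) * (Real.log (Real.log z) / Real.log (Real.log (Real.log z))) →
              (N : ℝ) ≤ z ^ (u + 2)) ∧
            (1 + (c / (u * Real.log u)) ^ u) * ((N : ℝ) * sieveDensity P z)
              ≤ (siftedCount (Finset.Ioc a (a + N)) P z : ℝ)) ∧
          (∃ a N : ℕ, z ^ u ≤ (N : ℝ) ∧
            (z₁ ≤ z →
              u ≤ (1 - ε) * (Real.log (Real.log z) / Real.log (Real.log (Real.log z))) →
              (N : ℝ) ≤ z ^ (u + 2)) ∧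
            (siftedCount (Finset.Ioc a (a + N)) P z : ℝ)
              ≤ (1 - (c / (u * Real.log u)) ^ u) * ((N : ℝ) * sieveDensity P z)) := by
  obtain ⟨c₁, z₀, hc₁, hlarge⟩ := exists_intervals_of_large hκ hK hu₀
  have hlu₀ : 0 < Real.log u₀ := Real.log_pos hu₀
  set Z := max z₀ 2 with hZ
  have hZ2 : 2 ≤ Z := le_max_right _ _
  -- B bounds zT + z for T = ⌈z^u⌉ and all z ≤ Z, u ≤ K√z; c is then small enough that δB ≤ 1/2.
  set B : ℝ := Z * (Z ^ (K * √Z) + 1) + Z with hB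
  have hB1 : 1 ≤ B := by
    have : 0 ≤ Z * (Z ^ (K * √Z) + 1) := by positivity
    linarith
  refine ⟨min c₁ (u₀ * Real.log u₀ / (2 * B)), by positivity, fun ε _ => ⟨z₀, ?_⟩⟩
  set c := min c₁ (u₀ * Real.log u₀ / (2 * B)) with hc
  have hc0 : 0 < c := by positivity
  intro z hz P hP hprop u hu huK
  rcases le_or_gt z₀ z with hzz | hzz
  · obtain ⟨⟨a, N, h1, h2, h3⟩, ⟨b, M, h4, h5, h6⟩⟩ :=
      hlarge c z hc0 (min_le_left _ _) hzz P hP hprop u hu huK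
    exact ⟨⟨a, N, h1, fun _ _ => h2, h3⟩, ⟨b, M, h4, fun _ _ => h5, h6⟩⟩
  · have hu1 : 1 < u := hu₀.trans_le hu
    have hlu : 0 < Real.log u := Real.log_pos hu1
    have hzZ : z ≤ Z := hzz.le.trans (le_max_left _ _)
    obtain ⟨p, hp, hpz⟩ := exists_mem_le_of_hasPrimeProportion hκ hz hprop
    have hbase : c / (u * Real.log u) ≤ 1 / (2 * B) := by
      have h1 : u₀ * Real.log u₀ ≤ u * Real.log u := by gcongr
      rw [div_le_iff₀ (by positivity)]
      calc c ≤ u₀ * Real.log u₀ / (2 * B) := min_le_right _ _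
        _ ≤ u * Real.log u / (2 * B) := by gcongr
        _ = _ := by ring
    have hδ : (c / (u * Real.log u)) ^ u ≤ 1 / (2 * B) := by
      have h1 : 1 / (2 * B) ≤ 1 := by rw [div_le_one (by positivity)]; linarith
      calc (c / (u * Real.log u)) ^ u ≤ (c / (u * Real.log u)) ^ (1 : ℝ) :=
            Real.rpow_le_rpow_of_exponent_ge (by positivity) (hbase.trans h1) hu1.le
        _ ≤ 1 / (2 * B) := by rwa [Real.rpow_one]
    have hTB : z * ⌈z ^ u⌉₊ + z ≤ B := by
      have h1 : (⌈z ^ u⌉₊ : ℝ) ≤ z ^ u + 1 := (Nat.ceil_lt_add_one (by positivity)).le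
      have h2 : z ^ u ≤ Z ^ (K * √Z) :=
        (Real.rpow_le_rpow (by linarith) hzZ (by linarith)).trans
          (Real.rpow_le_rpow_of_exponent_le (by linarith) (huK.trans (by gcongr)))
      rw [hB]
      gcongr
      linarith
    obtain ⟨⟨a, N, h1, h2⟩, ⟨b, M, h3, h4⟩⟩ := exists_intervals_of_prime hP hp hpz ⌈z ^ u⌉₊
      (δ := (c / (u * Real.log u)) ^ u) (by positivity) (by
        calc _ ≤ 1 / (2 * B) * B := by gcongr
          _ = 1 / 2 := by field_simp)
    exact ⟨⟨a, N, (Nat.le_ceil _).trans (by exact_mod_cast h1), fun h => absurd h hzz.not_ge, h2⟩,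
      ⟨b, M, (Nat.le_ceil _).trans (by exact_mod_cast h3), fun h => absurd h hzz.not_ge, h4⟩⟩
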